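/- Theorem 5.1. For a finite set $C$ of points of the unit sphere $\mathbb{S}^{n-1}\subset\mathbb{R}^n$ and $h:[-1,1]\to[0,+\infty]$ let $E(n,C;h)=\sum_{x,y\in C,\ x\neq y}h(\langle x,y\rangle)$, the sum being over ordered pairs. Let $\mathcal{U}(n,N,2;h)\in[0,+\infty]$ be the supremum of $E(n,C;h)$ over all spherical $2$-designs $C\subset\mathbb{S}^{n-1}$ with $|C|=N$, that is, over all $N$-point sets $C\subset\mathbb{S}^{n-1}$ such that every real polynomial in $n$ variables of total degree at most $2$ has the same average over $C$ as over $\mathbb{S}^{n-1}$ with respect to surface area measure (the supremum over the empty family is $0$). Let $n,N$ be integers with $N\in[n+1,2n)$, let $h:[-1,1]\to[0,+\infty]$ be convex (for instance any convex non-negative real-valued function), and let $$u=\frac{N-2}{n}-1,\qquad \ell=1-\frac{N}{n}.$$ (a) If $\ell<u$ and $h(\ell),h(u)$ are finite, then $$\mathcal{U}(n,N,2;h)\le\frac{N\big[(N-1)\big(u\,h(\ell)-\ell\,h(u)\big)+h(\ell)-h(u)\big]}{u-\ell}.$$ (b) If $\ell=u$, then $\mathcal{U}(n,N,2;h)=N(N-1)\,h\!\left(-\frac{1}{N-1}\right)$.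 -/

import Mathlib

open scoped ENNReal NNReal RealInnerProductSpace

namespace SphericalEnergy

/-- A spherical code in the unit sphere of `ℝⁿ`: a finite set of unit vectors. -/
def IsSphericalCode {n : ℕ} (C : Finset (EuclideanSpace ℝ (Fin n))) : Prop :=
  ∀ x ∈ C, x ∈ Metric.sphere (0 : EuclideanSpace ℝ (Fin n)) 1

/-- A spherical `τ`-design: a spherical code over which every real polynomial in `n` variables of
total degree at most `τ` has the same average as over the whole unit sphere. The measure
`volume.toSphere` is the surface area measure and `⨍` is the integral divided by the total mass. -/
def IsSphericalDesign {n : ℕ} (τ : ℕ) (C : Finset (EuclideanSpace ℝ (Fin n))) : Prop :=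
  IsSphericalCode C ∧
    ∀ f : MvPolynomial (Fin n) ℝ, f.totalDegree ≤ τ →
      (⨍ x : Metric.sphere (0 : EuclideanSpace ℝ (Fin n)) 1,
          MvPolynomial.eval (fun i => (x : EuclideanSpace ℝ (Fin n)) i) f
          ∂(MeasureTheory.volume : MeasureTheory.Measure (EuclideanSpace ℝ (Fin n))).toSphere)
        = (1 / (C.card : ℝ)) * ∑ x ∈ C, MvPolynomial.eval (fun i => x i) f

/-- The `h`-energy of `C`, the sum of `h ⟪x, y⟫` over all ordered pairs of distinct points of `C`.
The potential takes values in `[0, ∞]`; for unit vectors only its values on `[-1, 1]` matter. -/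
noncomputable def energy {n : ℕ} (C : Finset (EuclideanSpace ℝ (Fin n))) (h : ℝ → ℝ≥0∞) : ℝ≥0∞ :=
  ∑ p ∈ C.offDiag, h ⟪p.1, p.2⟫

/-- The supremum (in `[0, ∞]`) of the `h`-energies of the `N`-point spherical `τ`-designs on the
unit sphere of `ℝⁿ`. -/
noncomputable def maxEnergy (n N τ : ℕ) (h : ℝ → ℝ≥0∞) : ℝ≥0∞ :=
  sSup {e : ℝ≥0∞ | ∃ C : Finset (EuclideanSpace ℝ (Fin n)),
    C.card = N ∧ IsSphericalDesign τ C ∧ e = energy C h}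

end SphericalEnergy

/-! A `2`-design of `N` points has centroid zero and second moment matrix `(N / n) I`, so `∑ ⟪v, z⟫
= 0` and `∑ ⟪v, z⟫ ^ 2 = (N / n) ‖v‖ ^ 2` for every `v`. Taking `v = x - y` and `v = x + y` traps
every inner product of distinct points in `[l, u]` (`one_sub_card_div_le_inner`,
`inner_le_card_sub_two_div`). There `h` lies below its secant, whose sum over pairs depends only on
`∑ ⟪x, y⟫ = -N`; this gives (a). If `l = u`, then `N = n + 1` and all inner products coincide, so
every design has the same energy, and the regular simplex shows that a design exists. -/

namespace SphericalEnergy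

open MeasureTheory Metric Set
open scoped Pointwise

/-! ### Averages of low-degree monomials over the sphere, by symmetry. -/

section SurfaceMeasure

variable {E : Type*} [NormedAddCommGroup E] [InnerProductSpace ℝ E]

/-- The homeomorphism of the unit sphere induced by a linear isometry. -/
def sphereHomeomorph (f : E ≃ₗᵢ[ℝ] E) : sphere (0 : E) 1 ≃ₜ sphere (0 : E) 1 :=
  f.toHomeomorph.subtype fun x => by simp

theorem coe_sphereHomeomorph (f : E ≃ₗᵢ[ℝ] E) (x : sphere (0 : E) 1) :
    (sphereHomeomorph f x : E) = f x := rfl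

variable [FiniteDimensional ℝ E] [MeasurableSpace E] [BorelSpace E]

/-- The surface measure of `s` is a constant times the volume of the cone `Ioo 0 1 • s`; a linear
isometry maps cones to cones and preserves volume. -/
theorem measurePreserving_sphereHomeomorph (f : E ≃ₗᵢ[ℝ] E) :
    MeasurePreserving (sphereHomeomorph f) (volume : Measure E).toSphere
      (volume : Measure E).toSphere := by
  refine ⟨(sphereHomeomorph f).continuous.measurable, ?_⟩
  ext s hs
  have hs' := (sphereHomeomorph f).continuous.measurable hs
  rw [Measure.map_apply (sphereHomeomorph f).continuous.measurable hs,
    Measure.toSphere_apply' _ hs, Measure.toSphere_apply' _ hs',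
    ← f.measurePreserving.measure_preimage_equiv (f := f.toMeasurableEquiv)
      (Ioo (0 : ℝ) 1 • (Subtype.val '' s))]
  congr 2
  ext x
  simp only [Set.mem_smul, Set.mem_image, Set.mem_preimage]
  constructor
  · rintro ⟨r, hr, _, ⟨y, hy, rfl⟩, rfl⟩
    exact ⟨r, hr, _, ⟨_, hy, rfl⟩, (f.map_smul r (y : E)).symm⟩
  · rintro ⟨r, hr, _, ⟨y, hy, rfl⟩, hx⟩
    refine ⟨r, hr, _, ⟨(sphereHomeomorph f).symm y, by simpa using hy, rfl⟩, f.injective ?_⟩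
    rw [f.map_smul, ← coe_sphereHomeomorph, Homeomorph.apply_symm_apply]
    exact hx

theorem average_sphere_comp (f : E ≃ₗᵢ[ℝ] E) (g : E → ℝ) :
    ⨍ x : sphere (0 : E) 1, g (f x) ∂(volume : Measure E).toSphere
      = ⨍ x : sphere (0 : E) 1, g x ∂(volume : Measure E).toSphere := by
  rw [average_eq, average_eq]
  congr 1
  exact (measurePreserving_sphereHomeomorph f).integral_comp
    (sphereHomeomorph f).measurableEmbedding fun x => g x

end SurfaceMeasure

variable {n : ℕ}

/-- The reflection of `ℝⁿ` changing the sign of the `i`-th coordinate. -/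
noncomputable def coordReflection (i : Fin n) :
    EuclideanSpace ℝ (Fin n) ≃ₗᵢ[ℝ] EuclideanSpace ℝ (Fin n) :=
  LinearIsometryEquiv.piLpCongrRight 2
    fun k => if k = i then LinearIsometryEquiv.neg ℝ else LinearIsometryEquiv.refl ℝ ℝ

theorem coordReflection_apply_self (i : Fin n) (x : EuclideanSpace ℝ (Fin n)) :
    coordReflection i x i = -x i := by
  simp [coordReflection, LinearIsometryEquiv.piLpCongrRight_apply]

theorem coordReflection_apply_of_ne {i j : Fin n} (hij : j ≠ i) (x : EuclideanSpace ℝ (Fin n)) :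
    coordReflection i x j = x j := by
  simp [coordReflection, LinearIsometryEquiv.piLpCongrRight_apply, hij]

/-- The average of a function over the unit sphere of `ℝⁿ`. -/
noncomputable def sphereAverage (g : EuclideanSpace ℝ (Fin n) → ℝ) : ℝ :=
  ⨍ x : sphere (0 : EuclideanSpace ℝ (Fin n)) 1, g x
    ∂(volume : Measure (EuclideanSpace ℝ (Fin n))).toSphere

theorem sphereAverage_eq_zero_of_odd {g : EuclideanSpace ℝ (Fin n) → ℝ} (i : Fin n)
    (hg : ∀ x, g (coordReflection i x) = -g x) : sphereAverage g = 0 := by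
  have h : sphereAverage (fun x => g (coordReflection i x)) = sphereAverage g :=
    average_sphere_comp (coordReflection i) g
  simp only [hg] at h
  have h' : sphereAverage (fun x => -g x) = -sphereAverage g :=
    average_neg _ fun x : sphere (0 : EuclideanSpace ℝ (Fin n)) 1 => g x
  linarith

theorem sphereAverage_coord (i : Fin n) : sphereAverage (fun x => x i) = 0 :=
  sphereAverage_eq_zero_of_odd i (coordReflection_apply_self i)

theorem sphereAverage_coord_mul {i j : Fin n} (hij : i ≠ j) :
    sphereAverage (fun x => x i * x j) = 0 :=
  sphereAverage_eq_zero_of_odd i fun x => by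
    rw [coordReflection_apply_self, coordReflection_apply_of_ne hij.symm, neg_mul]

/-- In dimension `0` the sphere is empty and the average would be `0`. -/
theorem sphereAverage_const (hn : n ≠ 0) (c : ℝ) :
    sphereAverage (fun _ : EuclideanSpace ℝ (Fin n) => c) = c := by
  have : NeZero n := ⟨hn⟩
  have : NeZero (volume : Measure (EuclideanSpace ℝ (Fin n))).toSphere :=
    ⟨Measure.toSphere_ne_zero _⟩
  exact average_const _ c

theorem integrable_sphere {g : EuclideanSpace ℝ (Fin n) → ℝ} (hg : Continuous g) :
    Integrable (fun x : sphere (0 : EuclideanSpace ℝ (Fin n)) 1 => g x)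
      (volume : Measure (EuclideanSpace ℝ (Fin n))).toSphere :=
  (hg.comp continuous_subtype_val).integrable_of_hasCompactSupport
    (HasCompactSupport.of_compactSpace _)

theorem sphereAverage_finset_sum {ι : Type*} (s : Finset ι)
    {g : ι → EuclideanSpace ℝ (Fin n) → ℝ} (hg : ∀ k ∈ s, Continuous (g k)) :
    sphereAverage (fun x => ∑ k ∈ s, g k x) = ∑ k ∈ s, sphereAverage (g k) := by
  simp only [sphereAverage, average_eq]
  rw [integral_finsetSum _ fun k hk => integrable_sphere (hg k hk), Finset.smul_sum]

theorem sphereAverage_const_mul (c : ℝ) (g : EuclideanSpace ℝ (Fin n) → ℝ) :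
    sphereAverage (fun x => c * g x) = c * sphereAverage g := by
  simp only [sphereAverage, average_eq, integral_const_mul, smul_eq_mul]
  ring

theorem sphereAverage_coord_sq_eq (i j : Fin n) :
    sphereAverage (fun x => x i * x i) = sphereAverage (fun x => x j * x j) := by
  have h : sphereAverage (fun x => LinearIsometryEquiv.piLpCongrLeft 2 ℝ ℝ (Equiv.swap i j) x j *
      LinearIsometryEquiv.piLpCongrLeft 2 ℝ ℝ (Equiv.swap i j) x j)
      = sphereAverage (fun x => x j * x j) :=
    average_sphere_comp (LinearIsometryEquiv.piLpCongrLeft 2 ℝ ℝ (Equiv.swap i j))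
      fun x => x j * x j
  simpa [LinearIsometryEquiv.piLpCongrLeft_apply, Equiv.piCongrLeft'] using h

/-- The `n` squares have equal averages by swapping coordinates, and they sum to `1` on the sphere.
-/
theorem sphereAverage_coord_sq (i : Fin n) : sphereAverage (fun x => x i * x i) = 1 / n := by
  have hn : n ≠ 0 := fun h => (h ▸ i).elim0
  have h₁ : sphereAverage (fun x : EuclideanSpace ℝ (Fin n) => ∑ k, x k * x k) = 1 := by
    rw [← sphereAverage_const hn 1]
    refine congrArg (fun f => average _ f) (funext fun x => ?_)
    have hx : ‖(x : EuclideanSpace ℝ (Fin n))‖ ^ 2 = 1 := by simp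
    rw [EuclideanSpace.real_norm_sq_eq] at hx
    simpa only [sq] using hx
  rw [sphereAverage_finset_sum _ fun k _ => by fun_prop,
    Finset.sum_congr rfl fun k _ => sphereAverage_coord_sq_eq k i] at h₁
  have hn' : (n : ℝ) ≠ 0 := by exact_mod_cast hn
  simp only [Finset.sum_const, Finset.card_univ, Fintype.card_fin, nsmul_eq_mul] at h₁
  rw [eq_div_iff hn', mul_comm, h₁]

theorem sphereAverage_eval (f : MvPolynomial (Fin n) ℝ) :
    sphereAverage (fun x => MvPolynomial.eval (fun i => x i) f)
      = ∑ d ∈ f.support, f.coeff d * sphereAverage (fun x => ∏ i, x i ^ d i) := by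
  simp only [MvPolynomial.eval_eq']
  rw [sphereAverage_finset_sum _ fun d _ => by fun_prop]
  simp only [sphereAverage_const_mul]

/-! ### Designs of strength two in terms of moments. -/

/-- Quadratic moments of a point set characterising spherical `2`-designs. -/
structure HasIsotropicMoments (C : Finset (EuclideanSpace ℝ (Fin n))) : Prop where
  sum_coord : ∀ i, ∑ x ∈ C, x i = 0
  sum_coord_mul : ∀ i j, ∑ x ∈ C, x i * x j = if i = j then (C.card : ℝ) / n else 0

theorem IsSphericalDesign.hasIsotropicMoments {C : Finset (EuclideanSpace ℝ (Fin n))}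
    (hC : IsSphericalDesign 2 C) (hne : C.Nonempty) : HasIsotropicMoments C := by
  have hN : (C.card : ℝ) ≠ 0 := by exact_mod_cast hne.card_ne_zero
  constructor
  · intro i
    have h := hC.2 (MvPolynomial.X i) (by simp [MvPolynomial.totalDegree_X])
    simp only [MvPolynomial.eval_X] at h
    rw [show (⨍ x : sphere (0 : EuclideanSpace ℝ (Fin n)) 1, (x : EuclideanSpace ℝ (Fin n)) i
      ∂(volume : Measure (EuclideanSpace ℝ (Fin n))).toSphere) = 0 from sphereAverage_coord i] at h
    simpa [hne.ne_empty] using h.symm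
  · intro i j
    have h := hC.2 (MvPolynomial.X i * MvPolynomial.X j)
      ((MvPolynomial.totalDegree_mul _ _).trans (by simp [MvPolynomial.totalDegree_X]))
    simp only [map_mul, MvPolynomial.eval_X] at h
    change sphereAverage (fun x => x i * x j) = _ at h
    split_ifs with hij
    · subst hij
      rw [sphereAverage_coord_sq] at h
      rw [div_eq_mul_one_div, h]
      field_simp
    · rw [sphereAverage_coord_mul hij] at h
      simpa [hne.ne_empty] using h.symm

theorem exists_monomial_of_degree_le_two (d : Fin n →₀ ℕ) (hd : (d.sum fun _ e => e) ≤ 2) :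
    (∀ v : Fin n → ℝ, ∏ i, v i ^ d i = 1) ∨ (∃ k, ∀ v : Fin n → ℝ, ∏ i, v i ^ d i = v k) ∨
      ∃ k l, ∀ v : Fin n → ℝ, ∏ i, v i ^ d i = v k * v l := by
  -- A monomial is the product over the multiset of its variables, here of size at most `2`.
  have key : ∀ v : Fin n → ℝ, ∏ i, v i ^ d i = (d.toMultiset.map v).prod := by
    intro v
    rw [Finsupp.toMultiset_map, Finsupp.prod_toMultiset, Finsupp.prod_mapDomain_index
      (fun _ => pow_zero _) fun _ _ _ => pow_add _ _ _, Finsupp.prod_fintype _ _ fun _ => pow_zero _]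
  have hcard : d.toMultiset.card ≤ 2 := by
    rw [Finsupp.card_toMultiset]; exact hd
  simp only [key]
  generalize d.toMultiset = s at hcard
  interval_cases h : s.card
  · left
    simp [Multiset.card_eq_zero.1 h]
  · obtain ⟨k, rfl⟩ := Multiset.card_eq_one.1 h
    exact .inr (.inl ⟨k, by simp⟩)
  · obtain ⟨k, l, rfl⟩ := Multiset.card_eq_two.1 h
    exact .inr (.inr ⟨k, l, by simp⟩)

/-- This direction serves to certify the simplex as a design. -/
theorem HasIsotropicMoments.isSphericalDesign {C : Finset (EuclideanSpace ℝ (Fin n))}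
    (h : HasIsotropicMoments C) (hC : IsSphericalCode C) (hne : C.Nonempty) (hn : n ≠ 0) :
    IsSphericalDesign 2 C := by
  have hN : (C.card : ℝ) ≠ 0 := by exact_mod_cast hne.card_ne_zero
  refine ⟨hC, fun f hf => ?_⟩
  change sphereAverage (fun x => MvPolynomial.eval (fun i => x i) f) = _
  rw [sphereAverage_eval]
  simp only [MvPolynomial.eval_eq']
  rw [Finset.sum_comm, Finset.mul_sum]
  refine Finset.sum_congr rfl fun d hd => ?_
  rw [← Finset.mul_sum, mul_left_comm]
  congr 1
  rcases exists_monomial_of_degree_le_two d ((MvPolynomial.le_totalDegree hd).trans hf) with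
    h₀ | ⟨k, h₁⟩ | ⟨k, l, h₂⟩
  · simp only [h₀, sphereAverage_const hn, Finset.sum_const, nsmul_eq_mul, mul_one]
    field_simp
  · simp only [h₁, sphereAverage_coord, h.sum_coord, mul_zero]
  · simp only [h₂, h.sum_coord_mul]
    split_ifs with hkl
    · subst hkl
      rw [sphereAverage_coord_sq]
      field_simp
    · rw [sphereAverage_coord_mul hkl, mul_zero]

theorem HasIsotropicMoments.sum_inner {C : Finset (EuclideanSpace ℝ (Fin n))}
    (h : HasIsotropicMoments C) (v : EuclideanSpace ℝ (Fin n)) : ∑ z ∈ C, ⟪v, z⟫ = 0 := by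
  have h₀ : ∑ z ∈ C, z = 0 := by
    ext i
    simpa using h.sum_coord i
  rw [← inner_sum, h₀, inner_zero_right]

theorem HasIsotropicMoments.sum_inner_sq {C : Finset (EuclideanSpace ℝ (Fin n))}
    (h : HasIsotropicMoments C) (v : EuclideanSpace ℝ (Fin n)) :
    ∑ z ∈ C, ⟪v, z⟫ ^ 2 = C.card / n * ‖v‖ ^ 2 := by
  have h₁ : ∀ z : EuclideanSpace ℝ (Fin n),
      ⟪v, z⟫ ^ 2 = ∑ i, ∑ j, v i * v j * (z i * z j) := by
    intro z
    rw [PiLp.inner_apply, sq, Finset.sum_mul_sum]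
    refine Finset.sum_congr rfl fun i _ => Finset.sum_congr rfl fun j _ => ?_
    simp only [RCLike.inner_apply, conj_trivial]
    ring
  simp only [h₁]
  rw [Finset.sum_comm, EuclideanSpace.real_norm_sq_eq, Finset.mul_sum]
  refine Finset.sum_congr rfl fun i _ => ?_
  rw [Finset.sum_comm]
  simp only [← Finset.mul_sum, h.sum_coord_mul]
  simp
  ring

/-! ### Bounds on the inner products in a design. -/

section InnerBounds

variable {C : Finset (EuclideanSpace ℝ (Fin n))} {x y : EuclideanSpace ℝ (Fin n)}

theorem IsSphericalCode.norm_eq (hC : IsSphericalCode C) (hx : x ∈ C) : ‖x‖ = 1 := by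
  simpa using hC x hx

/-- With `t = ⟪x, y⟫`, keeping only `z = x, y` in the second moment along `x - y` gives `2(1 - t)² ≤
(N / n)(2 - 2t)`; divide by `1 - t > 0`. -/
theorem one_sub_card_div_le_inner (hC : IsSphericalCode C) (h : HasIsotropicMoments C)
    (hx : x ∈ C) (hy : y ∈ C) (hxy : x ≠ y) : 1 - (C.card : ℝ) / n ≤ ⟪x, y⟫ := by
  have hx₁ := hC.norm_eq hx
  have hy₁ := hC.norm_eq hy
  have ht : ⟪x, y⟫ < 1 := (inner_lt_one_iff_real_of_norm_eq_one hx₁ hy₁).2 hxy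
  have hle : ∑ z ∈ {x, y}, ⟪x - y, z⟫ ^ 2 ≤ ∑ z ∈ C, ⟪x - y, z⟫ ^ 2 :=
    Finset.sum_le_sum_of_subset_of_nonneg (by simp [Finset.insert_subset_iff, hx, hy])
      fun _ _ _ => sq_nonneg _
  rw [h.sum_inner_sq, Finset.sum_pair hxy, norm_sub_sq_real, inner_sub_left, inner_sub_left,
    real_inner_self_eq_norm_sq, real_inner_self_eq_norm_sq, real_inner_comm x y, hx₁, hy₁] at hle
  by_contra hcon
  nlinarith [mul_pos (sub_pos.2 ht) (sub_pos.2 (not_le.1 hcon))]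

/-- Along `x + y`, the other `N - 2` points have first moment `-2(1 + t)` and second moment `(N /
n)(2 + 2t) - 2(1 + t)²`; Cauchy–Schwarz compares the two. -/
theorem inner_le_card_sub_two_div (hC : IsSphericalCode C) (h : HasIsotropicMoments C)
    (hcard : 2 < C.card) (hx : x ∈ C) (hy : y ∈ C) (hxy : x ≠ y) :
    ⟪x, y⟫ ≤ ((C.card : ℝ) - 2) / n - 1 := by
  have hx₁ := hC.norm_eq hx
  have hy₁ := hC.norm_eq hy
  have hsub : ({x, y} : Finset _) ⊆ C := by simp [Finset.insert_subset_iff, hx, hy]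
  have hcs := sq_sum_le_card_mul_sum_sq (s := C \ {x, y}) (f := fun z => ⟪x + y, z⟫)
  have hs₁ := Finset.sum_sdiff hsub (f := fun z => ⟪x + y, z⟫)
  have hs₂ := Finset.sum_sdiff hsub (f := fun z => ⟪x + y, z⟫ ^ 2)
  have hc : ((C \ {x, y}).card : ℝ) = C.card - 2 := by
    rw [Finset.cast_card_sdiff hsub, Finset.card_pair hxy, Nat.cast_ofNat]
  have hN : (0 : ℝ) < C.card - 2 := by
    have : (2 : ℝ) < C.card := by exact_mod_cast hcard
    linarith
  rw [h.sum_inner, Finset.sum_pair hxy, inner_add_left, inner_add_left,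
    real_inner_self_eq_norm_sq, real_inner_self_eq_norm_sq, real_inner_comm x y, hx₁, hy₁] at hs₁
  rw [h.sum_inner_sq, Finset.sum_pair hxy, norm_add_sq_real, inner_add_left, inner_add_left,
    real_inner_self_eq_norm_sq, real_inner_self_eq_norm_sq, real_inner_comm x y, hx₁, hy₁] at hs₂
  rw [hc, eq_sub_of_add_eq hs₁, eq_sub_of_add_eq hs₂] at hcs
  rw [sub_div]
  generalize ⟪x, y⟫ = t at *
  have hnn : (0 : ℝ) ≤ (n : ℝ)⁻¹ := by positivity
  simp only [div_eq_mul_inv] at *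
  by_contra! hcon
  -- The negated bound itself excludes `t = -1`, so a factor `1 + t` can be cancelled.
  have h₁ : 0 < 1 + t := by nlinarith [mul_nonneg hN.le hnn]
  nlinarith [mul_pos (mul_pos h₁ (by linarith : (0 : ℝ) < C.card)) (sub_pos.2 hcon)]

end InnerBounds

/-- The full double sum vanishes because the centroid is zero, and the diagonal contributes `N`. -/
theorem sum_offDiag_inner {C : Finset (EuclideanSpace ℝ (Fin n))}
    (hC : IsSphericalCode C) (h : HasIsotropicMoments C) :
    ∑ p ∈ C.offDiag, ⟪p.1, p.2⟫ = -(C.card : ℝ) := by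
  have h₁ : ∑ p ∈ C ×ˢ C, ⟪p.1, p.2⟫ = 0 := by
    rw [Finset.sum_product]
    exact Finset.sum_eq_zero fun x _ => h.sum_inner x
  have h₂ : ∑ p ∈ C.diag, ⟪p.1, p.2⟫ = (C.card : ℝ) := by
    rw [Finset.sum_diag, Finset.sum_congr rfl fun x hx => by
      rw [real_inner_self_eq_norm_sq, hC.norm_eq hx, one_pow]]
    simp
  rw [← Finset.diag_union_offDiag, Finset.sum_union (Finset.disjoint_diag_offDiag _), h₂] at h₁
  linarith

end SphericalEnergy

/-! ### The regular simplex as a design. -/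

namespace SphericalEnergy

/-- The vertices of a simplex in `ℝⁿ`: one on the diagonal with coordinates `-s`, and the others
with coordinates `b`, except for one coordinate `a + b`. -/
noncomputable def simplexVertex (n : ℕ) (s a b : ℝ) : Option (Fin n) → EuclideanSpace ℝ (Fin n)
  | none => WithLp.toLp 2 fun _ => -s
  | some i => WithLp.toLp 2 fun k => (if k = i then a else 0) + b

theorem simplexVertex_none_apply {n : ℕ} (s a b : ℝ) (k : Fin n) :
    simplexVertex n s a b none k = -s := rfl

theorem simplexVertex_some_apply {n : ℕ} (s a b : ℝ) (i k : Fin n) :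
    simplexVertex n s a b (some i) k = (if k = i then a else 0) + b := rfl

theorem simplexVertex_injective {n : ℕ} {s a b : ℝ} (hs : s ≠ 0) (ha : a ≠ 0)
    (hab : a + n * b = s) (hs₂ : n * s ^ 2 = 1) : Function.Injective (simplexVertex n s a b) := by
  have hsum : ∀ i, ∑ k, simplexVertex n s a b (some i) k = s := fun i => by
    simp [simplexVertex_some_apply, Finset.sum_add_distrib, hab]
  have hne : ∀ i, simplexVertex n s a b none ≠ simplexVertex n s a b (some i) := fun i h => by
    have h₁ := hsum i
    rw [← h] at h₁
    simp only [simplexVertex_none_apply, Finset.sum_const, Finset.card_univ, Fintype.card_fin,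
      nsmul_eq_mul] at h₁
    have hs0 : 0 < s * s := mul_self_pos.2 hs
    nlinarith
  rintro (_ | i) (_ | j) h
  · rfl
  · exact (hne j h).elim
  · exact (hne i h.symm).elim
  · have h₁ := congrArg (fun x : EuclideanSpace ℝ (Fin n) => x i) h
    simp only [simplexVertex_some_apply, if_true] at h₁
    by_contra hij
    rw [if_neg fun h' => hij (congrArg some h')] at h₁
    exact ha (add_right_cancel h₁)

/-- The vertices of a regular simplex form a spherical `2`-design. -/
theorem exists_simplex_design {n : ℕ} (hn : n ≠ 0) :
    ∃ C : Finset (EuclideanSpace ℝ (Fin n)), C.card = n + 1 ∧ IsSphericalDesign 2 C := by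
  have hn' : (0 : ℝ) < n := by positivity
  -- The constants make all vertices unit with mutual inner products `-s ^ 2 = -1 / n`: `hab`
  -- handles pairs containing `none`, `hb` the other pairs, and `ha₂` with `hb` the norms.
  obtain ⟨s, hs, hs₂⟩ : ∃ s : ℝ, 0 < s ∧ n * s ^ 2 = 1 :=
    ⟨√(1 / n), by positivity, by rw [Real.sq_sqrt (by positivity)]; field_simp⟩
  obtain ⟨a, ha, ha₂⟩ : ∃ a : ℝ, 0 < a ∧ a ^ 2 = 1 + s ^ 2 :=
    ⟨√(1 + s ^ 2), by positivity, Real.sq_sqrt (by positivity)⟩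
  obtain ⟨b, hab⟩ : ∃ b : ℝ, a + n * b = s := ⟨(s - a) / n, by field_simp; ring⟩
  have hb : 2 * a * b + n * b ^ 2 = -s ^ 2 := by
    have : n * (2 * a * b + n * b ^ 2) = n * (-s ^ 2) := by
      linear_combination (a + n * b + s) * hab - ha₂ + hs₂
    exact mul_left_cancel₀ hn'.ne' this
  have hinj := simplexVertex_injective hs.ne' ha.ne' hab hs₂
  let C := (Finset.univ : Finset (Option (Fin n))).map ⟨_, hinj⟩
  have hsum : ∀ g : EuclideanSpace ℝ (Fin n) → ℝ, ∑ x ∈ C, g x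
      = g (simplexVertex n s a b none) + ∑ i, g (simplexVertex n s a b (some i)) := fun g => by
    simp [C, Fintype.sum_option]
  have hcard : C.card = n + 1 := by simp [C]
  have hcode : IsSphericalCode C := by
    intro x hx
    obtain ⟨o, -, rfl⟩ := Finset.mem_map.1 hx
    rw [mem_sphere_zero_iff_norm, ← sq_eq_sq₀ (norm_nonneg _) zero_le_one,
      EuclideanSpace.real_norm_sq_eq]
    rcases o with _ | i
    · simpa [simplexVertex_none_apply] using hs₂
    · simp only [Function.Embedding.coeFn_mk, simplexVertex_some_apply, add_sq, ite_pow,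
        Finset.sum_add_distrib, mul_ite, ite_mul]
      simp
      linarith
  refine ⟨C, hcard, HasIsotropicMoments.isSphericalDesign ⟨fun i => ?_, fun i j => ?_⟩ hcode
    (Finset.card_pos.1 (by omega)) hn⟩
  · rw [hsum]
    simp only [simplexVertex_none_apply, simplexVertex_some_apply, Finset.sum_add_distrib]
    simp
    linarith
  · rw [hsum, hcard]
    simp only [simplexVertex_none_apply, simplexVertex_some_apply, add_mul, mul_add,
      Finset.sum_add_distrib]
    simp
    split_ifs with hij
    · rw [eq_div_iff hn'.ne']
      linear_combination n * (ha₂ + hb) + hs₂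
    · linarith

/-! ### Energy estimates from convexity. -/

variable {h : ℝ → ℝ≥0∞} {l u t : ℝ}

/-- A `[0, ∞]`-valued convex function lies below its secant line. -/
theorem _root_.ConvexOn.le_secant {s : Set ℝ} (hconv : ConvexOn ℝ≥0 s h) (hl : l ∈ s)
    (hu : u ∈ s) (hlu : l < u) (hhl : h l ≠ ∞) (hhu : h u ≠ ∞) (hlt : l ≤ t) (htu : t ≤ u) :
    h t ≤ ENNReal.ofReal (((u - t) * (h l).toReal + (t - l) * (h u).toReal) / (u - l)) := by
  have hd : 0 < u - l := sub_pos.2 hlu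
  have ha : 0 ≤ (u - t) / (u - l) := div_nonneg (sub_nonneg.2 htu) hd.le
  have hb : 0 ≤ (t - l) / (u - l) := div_nonneg (sub_nonneg.2 hlt) hd.le
  have hcomb := hconv.2 hl hu (show 0 ≤ ((u - t) / (u - l)).toNNReal by simp)
    (show 0 ≤ ((t - l) / (u - l)).toNNReal by simp) (by
      rw [← Real.toNNReal_add ha hb, ← add_div, sub_add_sub_cancel, div_self hd.ne',
        Real.toNNReal_one])
  have ht : ((u - t) / (u - l)).toNNReal • l + ((t - l) / (u - l)).toNNReal • u = t := by
    rw [NNReal.smul_def, NNReal.smul_def, Real.coe_toNNReal _ ha, Real.coe_toNNReal _ hb,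
      smul_eq_mul, smul_eq_mul]
    field_simp
    ring
  rw [ht] at hcomb
  refine hcomb.trans (le_of_eq ?_)
  rw [add_div, ENNReal.ofReal_add (by positivity) (by positivity), mul_div_right_comm,
    mul_div_right_comm, ENNReal.ofReal_mul ha, ENNReal.ofReal_mul hb, ENNReal.ofReal_toReal hhl,
    ENNReal.ofReal_toReal hhu, ENNReal.smul_def, ENNReal.smul_def, smul_eq_mul, smul_eq_mul]
  rfl

variable {n N : ℕ} {C : Finset (EuclideanSpace ℝ (Fin n))}

theorem IsSphericalDesign.inner_mem_Icc (hC : IsSphericalDesign 2 C) (hcard : 2 < C.card)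
    {x y : EuclideanSpace ℝ (Fin n)} (hx : x ∈ C) (hy : y ∈ C) (hxy : x ≠ y) :
    ⟪x, y⟫ ∈ Set.Icc (1 - (C.card : ℝ) / n) (((C.card : ℝ) - 2) / n - 1) :=
  have hm := hC.hasIsotropicMoments ⟨x, hx⟩
  ⟨one_sub_card_div_le_inner hC.1 hm hx hy hxy, inner_le_card_sub_two_div hC.1 hm hcard hx hy hxy⟩

theorem card_offDiag_cast {α : Type*} [DecidableEq α] (s : Finset α) :
    (s.offDiag.card : ℝ) = s.card * (s.card - 1) := by
  rw [Finset.offDiag_card, Nat.cast_sub (Nat.le_mul_self _), Nat.cast_mul]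
  ring

theorem energy_le_of_secant (hC : IsSphericalDesign 2 C) (hne : C.Nonempty)
    (hlu : l < u) (hhl : h l ≠ ∞) (hhu : h u ≠ ∞) (hl : l ∈ Set.Icc (-1 : ℝ) 1)
    (hu : u ∈ Set.Icc (-1 : ℝ) 1) (hconv : ConvexOn ℝ≥0 (Set.Icc (-1 : ℝ) 1) h)
    (hmem : ∀ x ∈ C, ∀ y ∈ C, x ≠ y → ⟪x, y⟫ ∈ Set.Icc l u) :
    energy C h ≤ ENNReal.ofReal ((C.card : ℝ) *
      (((C.card : ℝ) - 1) * (u * (h l).toReal - l * (h u).toReal)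
          + (h l).toReal - (h u).toReal) / (u - l)) := by
  have hpair : ∀ p ∈ C.offDiag, ⟪p.1, p.2⟫ ∈ Set.Icc l u := fun p hp =>
    have hp := Finset.mem_offDiag.1 hp
    hmem _ hp.1 _ hp.2.1 hp.2.2
  have hd : 0 < u - l := sub_pos.2 hlu
  calc energy C h ≤ ∑ p ∈ C.offDiag, ENNReal.ofReal
        (((u - ⟪p.1, p.2⟫) * (h l).toReal + (⟪p.1, p.2⟫ - l) * (h u).toReal) / (u - l)) :=
        Finset.sum_le_sum fun p hp =>
          hconv.le_secant hl hu hlu hhl hhu (hpair p hp).1 (hpair p hp).2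
    _ = _ := by
        rw [← ENNReal.ofReal_sum_of_nonneg fun p hp => div_nonneg (add_nonneg
          (mul_nonneg (sub_nonneg.2 (hpair p hp).2) ENNReal.toReal_nonneg)
          (mul_nonneg (sub_nonneg.2 (hpair p hp).1) ENNReal.toReal_nonneg)) hd.le]
        congr 1
        rw [← Finset.sum_div]
        congr 1
        rw [Finset.sum_add_distrib, ← Finset.sum_mul, ← Finset.sum_mul, Finset.sum_sub_distrib,
          Finset.sum_sub_distrib, sum_offDiag_inner hC.1 (hC.hasIsotropicMoments hne),
          Finset.sum_const, Finset.sum_const, nsmul_eq_mul, nsmul_eq_mul, card_offDiag_cast]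
        ring

/-- Truncated subtraction is harmless: for empty `C` the first factor is zero. -/
theorem energy_eq_of_inner_eq (hC : ∀ x ∈ C, ∀ y ∈ C, x ≠ y → ⟪x, y⟫ = t) :
    energy C h = (C.card : ℝ≥0∞) * ((C.card : ℝ≥0∞) - 1) * h t := by
  rw [energy, Finset.sum_congr rfl fun p hp => by
    rw [hC _ (Finset.mem_offDiag.1 hp).1 _ (Finset.mem_offDiag.1 hp).2.1
      (Finset.mem_offDiag.1 hp).2.2], Finset.sum_const, nsmul_eq_mul, Finset.offDiag_card,
    ← Nat.mul_sub_one, Nat.cast_mul, ENNReal.natCast_sub, Nat.cast_one]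

end SphericalEnergy

theorem theorem5p1 (n N : ℕ) (hN₁ : n + 1 ≤ N) (hN₂ : N < 2 * n)
    (h : ℝ → ℝ≥0∞) (hconv : ConvexOn ℝ≥0 (Set.Icc (-1 : ℝ) 1) h)
    (u l : ℝ) (hu : u = ((N : ℝ) - 2) / n - 1) (hl : l = 1 - (N : ℝ) / n) :
    (l < u → h l ≠ ∞ → h u ≠ ∞ →
      (SphericalEnergy.maxEnergy n N 2 h : EReal) ≤
        (((N : ℝ) * (((N : ℝ) - 1) * (u * (h l).toReal - l * (h u).toReal)
          + (h l).toReal - (h u).toReal) / (u - l) : ℝ) : EReal)) ∧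
    (l = u →
      SphericalEnergy.maxEnergy n N 2 h
        = (N : ℝ≥0∞) * ((N : ℝ≥0∞) - 1) * h (-1 / ((N : ℝ) - 1))) := by
  have hn : (0 : ℝ) < n := by exact_mod_cast (by omega : 0 < n)
  have h₁ : (n : ℝ) + 1 ≤ N := by exact_mod_cast hN₁
  have h₂ : (N : ℝ) < 2 * n := by exact_mod_cast hN₂
  -- The range `n + 1 ≤ N < 2 * n` forces `n ≥ 2`.
  have h₃ : (3 : ℝ) ≤ N := by exact_mod_cast (by omega : 3 ≤ N)
  have hnu : n * u = N - 2 - n := by rw [hu]; field_simp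
  have hnl : n * l = n - N := by rw [hl]; field_simp
  have hmem : ∀ C : Finset (EuclideanSpace ℝ (Fin n)), C.card = N →
      SphericalEnergy.IsSphericalDesign 2 C →
      ∀ x ∈ C, ∀ y ∈ C, x ≠ y → ⟪x, y⟫ ∈ Set.Icc l u := by
    rintro C rfl hC x hx y hy hxy
    rw [hl, hu]
    exact hC.inner_mem_Icc (by omega) hx hy hxy
  constructor
  · intro hlu hhl hhu
    have hl_mem : l ∈ Set.Icc (-1 : ℝ) 1 := ⟨by nlinarith, by nlinarith⟩
    have hu_mem : u ∈ Set.Icc (-1 : ℝ) 1 := ⟨by nlinarith, by nlinarith⟩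
    have hle : SphericalEnergy.maxEnergy n N 2 h ≤ ENNReal.ofReal
        ((N : ℝ) * (((N : ℝ) - 1) * (u * (h l).toReal - l * (h u).toReal)
          + (h l).toReal - (h u).toReal) / (u - l)) := by
      refine sSup_le ?_
      rintro _ ⟨C, hcard, hC, rfl⟩
      have := SphericalEnergy.energy_le_of_secant hC (Finset.card_pos.1 (by omega)) hlu hhl hhu
        hl_mem hu_mem hconv (hmem C hcard hC)
      rwa [hcard] at this
    -- The bound is a multiple of the secant line at `-1 / (N - 1) ∈ [l, u]`.
    have hnonneg : 0 ≤ (N : ℝ) * (((N : ℝ) - 1) * (u * (h l).toReal - l * (h u).toReal)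
          + (h l).toReal - (h u).toReal) / (u - l) := by
      -- Multiplied by `n`, this quantity is `(N - 2)(N - 1 - n)` and the next one is `N(N - 1 -
      -- n)`.
      have hu' : 0 ≤ ((N : ℝ) - 1) * u + 1 := by
        refine nonneg_of_mul_nonneg_right (a := (n : ℝ)) ?_ hn
        nlinarith
      have hl' : 0 ≤ -(((N : ℝ) - 1) * l + 1) := by
        refine nonneg_of_mul_nonneg_right (a := (n : ℝ)) ?_ hn
        nlinarith
      refine div_nonneg (mul_nonneg (by linarith) ?_) (sub_pos.2 hlu).le
      linarith [mul_nonneg hu' (ENNReal.toReal_nonneg (a := h l)),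
        mul_nonneg hl' (ENNReal.toReal_nonneg (a := h u))]
    -- Nonnegativity is what makes `ENNReal.ofReal` of the bound equal to the bound.
    refine (EReal.coe_ennreal_le_coe_ennreal_iff.2 hle).trans_eq ?_
    rw [EReal.coe_ennreal_ofReal, max_eq_left hnonneg]
  · intro hlu
    have hN : N = n + 1 := by
      have : (N : ℝ) = n + 1 := by
        rw [hlu] at hnl
        linarith
      exact_mod_cast this
    have ht : u = -1 / ((N : ℝ) - 1) := by
      rw [eq_div_iff (by linarith), hN]
      rw [hN] at hnu
      push_cast at hnu ⊢
      linarith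
    have henergy : ∀ C : Finset (EuclideanSpace ℝ (Fin n)), C.card = N →
        SphericalEnergy.IsSphericalDesign 2 C → SphericalEnergy.energy C h
          = (N : ℝ≥0∞) * ((N : ℝ≥0∞) - 1) * h (-1 / ((N : ℝ) - 1)) := fun C hcard hC => by
      rw [SphericalEnergy.energy_eq_of_inner_eq (t := u), hcard, ht]
      intro x hx y hy hxy
      have := hmem C hcard hC x hx y hy hxy
      rwa [hlu, Set.Icc_self, Set.mem_singleton_iff] at this
    refine le_antisymm (sSup_le ?_) (le_sSup ?_)
    · rintro _ ⟨C, hcard, hC, rfl⟩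
      exact (henergy C hcard hC).le
    · obtain ⟨C, hcard, hC⟩ := SphericalEnergy.exists_simplex_design (n := n) (by omega)
      exact ⟨C, hcard.trans hN.symm, hC, (henergy C (hcard.trans hN.symm) hC).symm⟩
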